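/- All graphs are finite, simple and undirected. A graph $G$ of order $n$ is $m$-connected if $n>m$ and $G-X$ is connected for every $X\subseteq V(G)$ with $|X|<m$. For a connected graph $G$, $\mu_1(G)$ denotes the distance spectral radius, i.e. the largest eigenvalue of the distance matrix $D(G)=(d_G(u,v))_{u,v\in V(G)}$. For $b$ odd, a $[1,b]$-odd factor of a graph is a spanning subgraph $H$ with $d_H(v)\in\{1,3,\ldots,b\}$ for every vertex $v$. For $k\ge 1$, a graph $G$ of order $n\ge k+2$ is $k$-critical with respect to $[1,b]$-odd factors if $G-X$ contains a $[1,b]$-odd factor for every $X\subseteq V(G)$ with $|X|=k$. $K_m$ is the complete graph on $m$ vertices, $\cup$ is disjoint union, $tK_1$ is the graph with $t$ vertices and no edges, and $\vee$ is the join. Theorem 1.5. Let $b$, $k$ and $n$ be positive integers with $n\equiv k \pmod 2$ and $b\equiv 1\pmod 2$, and let $G$ be a $(k+1)$-connected graph of order $n$ with minimum degree $\delta$, where $$n\ge \max\left\{(2b^2+3b+11)\delta-\left(2b^2+\tfrac52 b+\tfrac32\right)k+\tfrac32 b+2+\tfrac{3}{2b},\ \tfrac23 b^2\delta^3+\tfrac43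 b^2k\delta^2\right\}.$$ If $$\mu_1(G)\le \mu_1\bigl(K_\delta\vee(K_{n-(b+1)\delta+bk-1}\cup(b\delta-bk+1)K_1)\bigr),$$ then $G$ is $k$-critical with respect to $[1,b]$-odd factors, unless $$G\cong K_\delta\vee(K_{n-(b+1)\delta+bk-1}\cup(b\delta-bk+1)K_1).$$ -/

import Mathlib

/-- The distance matrix `D(G)`: its `(u, v)` entry is the graph distance between `u` and `v`. -/
noncomputable def distMatrix {V : Type*} (G : SimpleGraph V) : Matrix V V ℝ :=
  Matrix.of fun u v => (G.dist u v : ℝ)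

theorem distMatrix_isHermitian {V : Type*} (G : SimpleGraph V) : (distMatrix G).IsHermitian := by
  ext u v
  simp [distMatrix, SimpleGraph.dist_comm]

/-- The distance spectral radius `μ₁(G)`: the largest eigenvalue of the distance matrix.
(The supremum runs over the finite family of all eigenvalues, so it is a maximum as soon as `V`
is nonempty.) -/
noncomputable def distSpectralRadius {V : Type*} [Fintype V] [DecidableEq V]
    (G : SimpleGraph V) : ℝ :=
  ⨆ i : V, (distMatrix_isHermitian G).eigenvalues i

/-- The join `G ∨ H`: the disjoint union of `G` and `H` together with all edges between
the two vertex sets. -/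
def graphJoin {V W : Type*} (G : SimpleGraph V) (H : SimpleGraph W) : SimpleGraph (V ⊕ W) :=
  SimpleGraph.sum G H ⊔ completeBipartiteGraph V W

/-- The graph `K_s ∨ (K_m ∪ t K₁)`. -/
def joinGraph (s m t : ℕ) : SimpleGraph (Fin s ⊕ (Fin m ⊕ Fin t)) :=
  graphJoin (⊤ : SimpleGraph (Fin s))
    (SimpleGraph.sum (⊤ : SimpleGraph (Fin m)) (⊥ : SimpleGraph (Fin t)))

/-- `G` is `k`-connected: `G` has more than `k` vertices and deleting fewer than `k` vertices
always leaves a connected graph. -/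
def IsKConnected {V : Type*} [Fintype V] (G : SimpleGraph V) (k : ℕ) : Prop :=
  k < Fintype.card V ∧
    ∀ X : Finset V, X.card < k → (G.induce {v : V | v ∉ X}).Connected

/-- `G` contains a `[1,b]`-odd factor (`b` odd): a spanning subgraph `H` all of whose degrees lie
in `{1, 3, …, b}`. The degree of `v` in `H` is the number of its neighbours. -/
def HasOddFactor {V : Type*} [Finite V] (G : SimpleGraph V) (b : ℕ) : Prop :=
  ∃ H : SimpleGraph V, H ≤ G ∧
    ∀ v : V, Odd (H.neighborSet v).ncard ∧ (H.neighborSet v).ncard ≤ b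

/-- `G`, of order at least `k + 2`, is `k`-critical with respect to `[1,b]`-odd factors: deleting
any `k` vertices leaves a graph that contains a `[1,b]`-odd factor. -/
def IsKCriticalOddFactor {V : Type*} [Fintype V] (G : SimpleGraph V) (k b : ℕ) : Prop :=
  k + 2 ≤ Fintype.card V ∧
    ∀ X : Finset V, X.card = k → HasOddFactor (G.induce {v : V | v ∉ X}) b

/-- The extremal graph `K_δ ∨ (K_{n-(b+1)δ+bk-1} ∪ (bδ-bk+1) K₁)`. Both subtractions are exact
whenever `k ≤ δ` and `(b + 1) δ + 1 ≤ n + b k`. -/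
def extremalGraph (n b k δ : ℕ) :
    SimpleGraph (Fin δ ⊕ (Fin (n + b * k - (b + 1) * δ - 1) ⊕ Fin (b * δ - b * k + 1))) :=
  joinGraph δ (n + b * k - (b + 1) * δ - 1) (b * δ - b * k + 1)

/-!
Spectral side. The extremal graph `K = K_δ ∨ (K_m ∪ t K₁)` has diameter two and a Perron vector
with constant values `A`, `B`, `C` on its three blocks. In a connected graph nonadjacent vertices
are at distance at least two, so `xᵀ D(G) x ≥ xᵀ (J - I) x + xᵀ A(Gᶜ) x` for `x ≥ 0`, with equality
for `K`. Hence `μ₁(G) ≤ μ₁(K)` bounds the weight of the nonadjacent pairs of `G` by that of `K`,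
for every placement of the values `A`, `B`, `C` on the vertices of `G`.

Combinatorial side. A graph has a `[1,b]`-odd factor as soon as its blow-up by cliques `K_b` has a
perfect matching: keep the edges of odd multiplicity. By Tutte's theorem, a graph `G` that is not
`k`-critical has a set `S` of `k + r` vertices such that `G - S` has at least `b r + 2` components.

Let `d = δ - k`. If `r < d`, every component has more than `d - r` vertices and the pairs between
the largest component and the others are already too heavy. If `r > d`, there are so many components
that moving all but one vertex of each of them into the largest one, which only lowers the weight,
still leaves too many nonadjacent pairs. If `r = d`, this move leaves exactly the weight of `K`, so
every estimate is an equality and `G` is `K`.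
-/

section Spectral

open Matrix
open scoped MatrixOrder

variable {V : Type*} [Fintype V] [DecidableEq V]

theorem le_algebraMap_iSup_eigenvalues {M : Matrix V V ℝ} (hM : M.IsHermitian) :
    M ≤ algebraMap ℝ (Matrix V V ℝ) (⨆ i, hM.eigenvalues i) := by
  refine le_algebraMap_of_spectrum_le (fun μ hμ => ?_) hM.isSelfAdjoint
  rw [hM.spectrum_real_eq_range_eigenvalues] at hμ
  obtain ⟨i, rfl⟩ := hμ
  exact le_ciSup (Set.finite_range _).bddAbove i

theorem dotProduct_algebraMap_sub_mulVec (M : Matrix V V ℝ) (c : ℝ) (x : V → ℝ) :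
    x ⬝ᵥ ((algebraMap ℝ (Matrix V V ℝ) c - M) *ᵥ x) = c * (x ⬝ᵥ x) - x ⬝ᵥ (M *ᵥ x) := by
  rw [Algebra.algebraMap_eq_smul_one, sub_mulVec, smul_mulVec, one_mulVec, dotProduct_sub,
    dotProduct_smul, smul_eq_mul]

theorem dotProduct_mulVec_le_iSup_eigenvalues {M : Matrix V V ℝ} (hM : M.IsHermitian)
    (x : V → ℝ) : x ⬝ᵥ (M *ᵥ x) ≤ (⨆ i, hM.eigenvalues i) * (x ⬝ᵥ x) := by
  have h := (le_iff.1 (le_algebraMap_iSup_eigenvalues hM)).dotProduct_mulVec_nonneg x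
  rw [star_trivial, dotProduct_algebraMap_sub_mulVec] at h
  exact sub_nonneg.1 h

theorem mulVec_eq_iSup_eigenvalues_smul {M : Matrix V V ℝ} (hM : M.IsHermitian) {x : V → ℝ}
    (hx : (⨆ i, hM.eigenvalues i) * (x ⬝ᵥ x) ≤ x ⬝ᵥ (M *ᵥ x)) :
    M *ᵥ x = (⨆ i, hM.eigenvalues i) • x := by
  have hP := le_iff.1 (le_algebraMap_iSup_eigenvalues hM)
  have h := (hP.dotProduct_mulVec_zero_iff x).1 <| by
    refine le_antisymm ?_ (hP.dotProduct_mulVec_nonneg x)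
    rw [star_trivial, dotProduct_algebraMap_sub_mulVec]
    exact sub_nonpos.2 hx
  rw [Algebra.algebraMap_eq_smul_one, sub_mulVec, smul_mulVec, one_mulVec, sub_eq_zero] at h
  exact h.symm

theorem exists_nonneg_eigenvector [Nonempty V] {M : Matrix V V ℝ} (hM : M.IsHermitian)
    (hM0 : ∀ u v, 0 ≤ M u v) :
    ∃ x : V → ℝ, 0 ≤ x ∧ x ≠ 0 ∧ M *ᵥ x = (⨆ i, hM.eigenvalues i) • x := by
  obtain ⟨i, hi⟩ := exists_eq_ciSup_of_finite (f := hM.eigenvalues)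
  set z : V → ℝ := ⇑(hM.eigenvectorBasis i) with hz
  have hz0 : z ≠ 0 := fun h =>
    hM.eigenvectorBasis.orthonormal.ne_zero i (PiLp.ext fun v => congrFun h v)
  refine ⟨|z|, abs_nonneg z, fun h => hz0 (funext fun v => abs_eq_zero.1 (congrFun h v)),
    mulVec_eq_iSup_eigenvalues_smul hM ?_⟩
  calc (⨆ j, hM.eigenvalues j) * (|z| ⬝ᵥ |z|) = z ⬝ᵥ (M *ᵥ z) := by
        rw [hz, hM.mulVec_eigenvectorBasis, hi, dotProduct_smul, smul_eq_mul]
        simp only [dotProduct, Pi.abs_apply, abs_mul_abs_self]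
    _ ≤ |z| ⬝ᵥ (M *ᵥ |z|) := by
        simp only [dotProduct, mulVec, Finset.mul_sum, Pi.abs_apply]
        refine Finset.sum_le_sum fun u _ => Finset.sum_le_sum fun v _ => ?_
        calc z u * (M u v * z v) ≤ |z u * (M u v * z v)| := le_abs_self _
          _ = |z u| * (M u v * |z v|) := by rw [abs_mul, abs_mul, abs_of_nonneg (hM0 u v)]

end Spectral

section AdjForm

open Matrix

variable {V W : Type*} [Fintype V] [Fintype W]

open Classical in
/-- The quadratic form of the adjacency matrix of `G`: the sum of `x u * x v` over the ordered
pairs of adjacent vertices. For `Gᶜ` it is the weight of the nonadjacent pairs of `G`, through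
which distance spectral radii are compared. -/
noncomputable def adjForm (G : SimpleGraph V) (x : V → ℝ) : ℝ :=
  x ⬝ᵥ (G.adjMatrix ℝ *ᵥ x)

open Classical in
theorem adjForm_eq_sum (G : SimpleGraph V) (x : V → ℝ) :
    adjForm G x = ∑ u, ∑ v, if G.Adj u v then x u * x v else 0 :=
  G.dotProduct_mulVec_adjMatrix x x

theorem adjForm_mono {G H : SimpleGraph V} (hGH : G ≤ H) {x : V → ℝ} (hx : 0 ≤ x) :
    adjForm G x ≤ adjForm H x := by
  classical
  simp only [adjForm_eq_sum]
  gcongr with u _ v _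
  have huv : 0 ≤ x u * x v := mul_nonneg (hx u) (hx v)
  split_ifs with hG hH hH
  exacts [le_rfl, absurd (hGH hG) hH, huv, le_rfl]

theorem eq_of_le_of_adjForm_le {G H : SimpleGraph V} (hGH : G ≤ H) {x : V → ℝ}
    (hx : ∀ v, 0 < x v) (h : adjForm H x ≤ adjForm G x) : G = H := by
  classical
  by_contra hne
  obtain ⟨a, b, hab, hab'⟩ : ∃ a b, H.Adj a b ∧ ¬ G.Adj a b := by
    by_contra! hHG
    exact hne (hGH.antisymm fun a b => hHG a b)
  have hle : ∀ u v, (if G.Adj u v then x u * x v else 0) ≤ if H.Adj u v then x u * x v else 0 := by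
    intro u v
    have huv := (mul_pos (hx u) (hx v)).le
    split_ifs with hG hH hH
    exacts [le_rfl, absurd (hGH hG) hH, huv, le_rfl]
  simp only [adjForm_eq_sum] at h
  refine h.not_gt (Finset.sum_lt_sum (fun u _ => Finset.sum_le_sum fun v _ => hle u v)
    ⟨a, Finset.mem_univ a, Finset.sum_lt_sum (fun v _ => hle a v) ⟨b, Finset.mem_univ b, ?_⟩⟩)
  rw [if_pos hab, if_neg hab']
  exact mul_pos (hx a) (hx b)

theorem adjForm_top_comp_equiv (e : V ≃ W) (x : W → ℝ) :
    adjForm ⊤ (x ∘ e) = adjForm ⊤ x := by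
  classical
  simp only [adjForm_eq_sum]
  refine Fintype.sum_equiv e _ _ fun u => Fintype.sum_equiv e _ _ fun v => ?_
  simp only [SimpleGraph.top_adj, Function.comp_apply, e.injective.ne_iff]

end AdjForm

section Distance

open Matrix

theorem ite_adj_le_dist {V : Type*} [DecidableEq V] {G : SimpleGraph V} [DecidableRel G.Adj]
    (hG : G.Connected) (u v : V) :
    (if u = v then 0 else if G.Adj u v then 1 else 2) ≤ G.dist u v := by
  split_ifs with huv hadj
  · exact Nat.zero_le _
  · exact (SimpleGraph.dist_eq_one_iff_adj.2 hadj).ge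
  · have h0 : 0 < G.dist u v := hG.pos_dist_of_ne huv
    have h1 : G.dist u v ≠ 1 := mt SimpleGraph.dist_eq_one_iff_adj.1 hadj
    omega

theorem dist_eq_ite_adj {V : Type*} [DecidableEq V] {G : SimpleGraph V} [DecidableRel G.Adj]
    (hG : G.Connected) (h : ∀ u v, G.dist u v ≤ 2) (u v : V) :
    G.dist u v = if u = v then 0 else if G.Adj u v then 1 else 2 := by
  refine le_antisymm ?_ (ite_adj_le_dist hG u v)
  split_ifs with huv hadj
  · exact (SimpleGraph.dist_eq_zero_iff_eq_or_not_reachable.2 (Or.inl huv)).le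
  · exact (SimpleGraph.dist_eq_one_iff_adj.2 hadj).le
  · exact h u v

variable {V W : Type*} [Fintype V] [Fintype W]

theorem adjForm_top_add_compl [DecidableEq V] (G : SimpleGraph V) [DecidableRel G.Adj] (x : V → ℝ) :
    adjForm ⊤ x + adjForm Gᶜ x =
      ∑ u, ∑ v, x u * ((if u = v then 0 else if G.Adj u v then 1 else 2) * x v) := by
  simp only [adjForm_eq_sum, ← Finset.sum_add_distrib]
  refine Finset.sum_congr rfl fun u _ => Finset.sum_congr rfl fun v _ => ?_
  by_cases huv : u = v
  · simp [huv]
  by_cases hadj : G.Adj u v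
  · simp [huv, hadj]
  · simp only [SimpleGraph.top_adj, ne_eq, huv, not_false_eq_true, if_true,
      SimpleGraph.compl_adj, hadj, and_self, if_false]
    ring

theorem adjForm_top_add_compl_le [DecidableEq V] {G : SimpleGraph V} (hG : G.Connected)
    {x : V → ℝ} (hx : 0 ≤ x) :
    adjForm ⊤ x + adjForm Gᶜ x ≤ distSpectralRadius G * (x ⬝ᵥ x) := by
  classical
  refine le_trans ?_ (dotProduct_mulVec_le_iSup_eigenvalues (distMatrix_isHermitian G) x)
  simp only [adjForm_top_add_compl, dotProduct, mulVec, Finset.mul_sum, distMatrix, of_apply]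
  gcongr with u _ v _
  exacts [hx u, hx v, by exact_mod_cast ite_adj_le_dist hG u v]

theorem adjForm_top_add_compl_eq {G : SimpleGraph V} (hG : G.Connected)
    (h : ∀ u v, G.dist u v ≤ 2) (x : V → ℝ) :
    adjForm ⊤ x + adjForm Gᶜ x = x ⬝ᵥ (distMatrix G *ᵥ x) := by
  classical
  simp only [adjForm_top_add_compl, dotProduct, mulVec, Finset.mul_sum, distMatrix, of_apply,
    dist_eq_ite_adj hG h, Nat.cast_ite, Nat.cast_zero, Nat.cast_one, Nat.cast_ofNat]

theorem adjForm_compl_comp_equiv_le [DecidableEq V] [DecidableEq W] {G : SimpleGraph V}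
    {H : SimpleGraph W} (hG : G.Connected) (hH : H.Connected) (hdiam : ∀ u v, H.dist u v ≤ 2)
    (hμ : distSpectralRadius G ≤ distSpectralRadius H) (e : V ≃ W) {x : W → ℝ} (hx : 0 ≤ x)
    (hHx : distMatrix H *ᵥ x = distSpectralRadius H • x) :
    adjForm Gᶜ (x ∘ e) ≤ adjForm Hᶜ x := by
  have hxx : 0 ≤ x ⬝ᵥ x := Finset.sum_nonneg fun v _ => mul_self_nonneg (x v)
  have h : adjForm ⊤ x + adjForm Gᶜ (x ∘ e) ≤ adjForm ⊤ x + adjForm Hᶜ x :=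
    calc adjForm ⊤ x + adjForm Gᶜ (x ∘ e)
        ≤ distSpectralRadius G * ((x ∘ e) ⬝ᵥ (x ∘ e)) := by
          rw [← adjForm_top_comp_equiv e x]
          exact adjForm_top_add_compl_le hG fun v => hx (e v)
      _ ≤ distSpectralRadius H * (x ⬝ᵥ x) := by
          rw [comp_equiv_dotProduct_comp_equiv]
          exact mul_le_mul_of_nonneg_right hμ hxx
      _ = adjForm ⊤ x + adjForm Hᶜ x := by
          rw [adjForm_top_add_compl_eq hH hdiam, hHx, dotProduct_smul, smul_eq_mul]
  exact le_of_add_le_add_left h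

end Distance

section JoinGraph

open Matrix

variable {s m t : ℕ}

theorem joinGraph_exists_walk_length_le_two (hs : 0 < s) (u v : Fin s ⊕ (Fin m ⊕ Fin t)) :
    ∃ p : (joinGraph s m t).Walk u v, p.length ≤ 2 := by
  have hinl : ∀ a w, Sum.inl a = w ∨ (joinGraph s m t).Adj (Sum.inl a) w := by
    rintro a (c | w)
    · simpa [joinGraph, graphJoin] using em (a = c)
    · simp [joinGraph, graphJoin]
  have hcenter : ∀ w, (joinGraph s m t).Adj (Sum.inl ⟨0, hs⟩) (Sum.inr w) := fun w =>
    (hinl _ _).resolve_left Sum.inl_ne_inr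
  rcases u with a | u
  · obtain rfl | h := hinl a v
    exacts [⟨.nil, Nat.zero_le 2⟩, ⟨.cons h .nil, one_le_two⟩]
  rcases v with c | v
  · exact ⟨.cons ((hinl c (Sum.inr u)).resolve_left Sum.inl_ne_inr).symm .nil, one_le_two⟩
  · exact ⟨.cons (hcenter u).symm (.cons (hcenter v) .nil), le_rfl⟩

theorem joinGraph_connected (hs : 0 < s) : (joinGraph s m t).Connected where
  preconnected u v := ⟨(joinGraph_exists_walk_length_le_two hs u v).choose⟩
  nonempty := ⟨Sum.inl ⟨0, hs⟩⟩

theorem joinGraph_dist_le_two (hs : 0 < s) (u v : Fin s ⊕ (Fin m ⊕ Fin t)) :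
    (joinGraph s m t).dist u v ≤ 2 :=
  let ⟨p, hp⟩ := joinGraph_exists_walk_length_le_two hs u v
  (SimpleGraph.dist_le p).trans hp

theorem sum_ite_eq_zero {ι : Type*} [Fintype ι] [DecidableEq ι] (i : ι) (f : ι → ℝ) :
    ∑ j, (if i = j then 0 else f j) = ∑ j, f j - f i := by
  rw [← Finset.sum_erase_eq_sub (Finset.mem_univ i), ← Finset.filter_ne, Finset.sum_filter]
  exact Finset.sum_congr rfl fun j _ => (ite_not (i = j) _ _).symm

theorem distMatrix_joinGraph_mulVec (hs : 0 < s) (x : Fin s ⊕ (Fin m ⊕ Fin t) → ℝ) :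
    distMatrix (joinGraph s m t) *ᵥ x =
      Sum.elim (fun a => ∑ v, x v - x (Sum.inl a))
        (Sum.elim (fun a => ∑ v, x v + ∑ c, x (Sum.inr (Sum.inr c)) - x (Sum.inr (Sum.inl a)))
          fun a => ∑ v, x v + ∑ c, x (Sum.inr (Sum.inl c)) + ∑ c, x (Sum.inr (Sum.inr c))
            - 2 * x (Sum.inr (Sum.inr a))) := by
  classical
  have hite : ∀ (p : Prop) [Decidable p] (a b c : ℝ),
      (if p then a else if p then b else c) = if p then a else c := by
    intro p _ a b c
    split_ifs <;> rfl
  ext (a | a | a) <;>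
    simp only [mulVec, dotProduct, distMatrix, of_apply, Fintype.sum_sum_type, Sum.elim_inl,
      Sum.elim_inr, dist_eq_ite_adj (joinGraph_connected hs) (joinGraph_dist_le_two hs)] <;>
    simp [joinGraph, graphJoin, hite, ← Finset.mul_sum, sum_ite_eq_zero] <;>
    ring

theorem adjForm_compl_joinGraph (A B C : ℝ) :
    adjForm (joinGraph s m t)ᶜ (Sum.elim (fun _ => A) (Sum.elim (fun _ => B) fun _ => C)) =
      2 * t * m * (B * C) + t * (t - 1) * C ^ 2 := by
  classical
  simp only [adjForm_eq_sum, Fintype.sum_sum_type, Sum.elim_inl, Sum.elim_inr]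
  simp [joinGraph, graphJoin, sum_ite_eq_zero]
  ring

theorem joinGraph_eigenvalue_equations (hs : 0 < s) {x : Fin s ⊕ (Fin m ⊕ Fin t) → ℝ} {μ : ℝ}
    (hx : distMatrix (joinGraph s m t) *ᵥ x = μ • x) :
    (∀ a, (μ + 1) * x (Sum.inl a) = ∑ v, x v) ∧
      (∀ a, (μ + 1) * x (Sum.inr (Sum.inl a)) = ∑ v, x v + ∑ c, x (Sum.inr (Sum.inr c))) ∧
      ∀ a, (μ + 2) * x (Sum.inr (Sum.inr a)) =
        ∑ v, x v + ∑ c, x (Sum.inr (Sum.inl c)) + ∑ c, x (Sum.inr (Sum.inr c)) := by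
  have hrow := fun v => congrFun (hx.symm.trans (distMatrix_joinGraph_mulVec hs x)) v
  simp only [Pi.smul_apply, smul_eq_mul, Sum.forall, Sum.elim_inl, Sum.elim_inr] at hrow
  obtain ⟨h₁, h₂, h₃⟩ := hrow
  exact ⟨fun a => by linarith [h₁ a], fun a => by linarith [h₂ a], fun a => by linarith [h₃ a]⟩

theorem exists_joinGraph_eigenvector (hs : 0 < s) (ht : 0 < t) :
    ∃ A B C : ℝ, 0 < A ∧ A < B ∧ 0 < C ∧ C ≤ 2 * A ∧
      distMatrix (joinGraph s m t) *ᵥ Sum.elim (fun _ => A) (Sum.elim (fun _ => B) fun _ => C) =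
        distSpectralRadius (joinGraph s m t) •
          Sum.elim (fun _ => A) (Sum.elim (fun _ => B) fun _ => C) := by
  have : Nonempty (Fin s) := ⟨⟨0, hs⟩⟩
  obtain ⟨x, hx0, hxne, hx⟩ := exists_nonneg_eigenvector (distMatrix_isHermitian (joinGraph s m t))
    fun u v => Nat.cast_nonneg ((joinGraph s m t).dist u v)
  change _ = distSpectralRadius (joinGraph s m t) • x at hx
  obtain ⟨h₁, h₂, h₃⟩ := joinGraph_eigenvalue_equations hs hx
  set μ := distSpectralRadius (joinGraph s m t)
  set X := ∑ v, x v
  set X₂ := ∑ c, x (Sum.inr (Sum.inl c))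
  set X₃ := ∑ c, x (Sum.inr (Sum.inr c))
  have hX : 0 < X := Fintype.sum_pos (hx0.lt_of_ne' hxne)
  have hX₂ : 0 ≤ X₂ := Finset.sum_nonneg fun c _ => hx0 _
  have hX₃ : 0 ≤ X₃ := Finset.sum_nonneg fun c _ => hx0 _
  have hμ : 0 < μ + 1 := pos_of_mul_pos_left (h₁ ⟨0, hs⟩ ▸ hX) (hx0 _)
  have hμ' : 0 < μ + 2 := by linarith
  have hxeq : x = Sum.elim (fun _ => X / (μ + 1))
      (Sum.elim (fun _ => (X + X₃) / (μ + 1)) fun _ => (X + X₂ + X₃) / (μ + 2)) := by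
    ext (a | a | a)
    exacts [eq_div_of_mul_eq hμ.ne' ((mul_comm _ _).trans (h₁ a)),
      eq_div_of_mul_eq hμ.ne' ((mul_comm _ _).trans (h₂ a)),
      eq_div_of_mul_eq hμ'.ne' ((mul_comm _ _).trans (h₃ a))]
  have hX₃' : 0 < X₃ := by
    refine Finset.sum_pos (fun a _ => (mul_pos_iff_of_pos_left hμ').1 ?_)
      ⟨⟨0, ht⟩, Finset.mem_univ _⟩
    rw [h₃]
    positivity
  have hle : X₂ + X₃ ≤ X := by
    simp only [X, X₂, X₃, Fintype.sum_sum_type]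
    exact le_add_of_nonneg_left (Finset.sum_nonneg fun c _ => hx0 _)
  refine ⟨_, _, _, by positivity, ?_, by positivity, ?_, hxeq ▸ hx⟩
  · gcongr
    linarith
  · rw [← mul_div_assoc]
    exact div_le_div₀ (by linarith) (by linarith) hμ (by linarith)

end JoinGraph

section Blocks

theorem exists_equiv_of_disjoint {V : Type*} [Fintype V] {Z₁ Z₃ : Finset V}
    (hZ : Disjoint Z₁ Z₃) {s m t : ℕ} (h₁ : Z₁.card = s) (h₃ : Z₃.card = t)
    (hcard : Fintype.card V = s + (m + t)) :
    ∃ e : Fin s ⊕ (Fin m ⊕ Fin t) ≃ V, (∀ a, e (Sum.inl a) ∈ Z₁) ∧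
      (∀ a, e (Sum.inr (Sum.inl a)) ∉ Z₁ ∧ e (Sum.inr (Sum.inl a)) ∉ Z₃) ∧
      ∀ a, e (Sum.inr (Sum.inr a)) ∈ Z₃ := by
  classical
  have h₂ : (Z₁ ∪ Z₃)ᶜ.card = m := by
    rw [Finset.card_compl, Finset.card_union_of_disjoint hZ]
    omega
  let e₁ := Z₁.equivFinOfCardEq h₁
  let e₂ := (Z₁ ∪ Z₃)ᶜ.equivFinOfCardEq h₂
  let e₃ := Z₃.equivFinOfCardEq h₃
  have hmem₂ : ∀ a, (e₂.symm a : V) ∉ Z₁ ∧ (e₂.symm a : V) ∉ Z₃ := fun a => by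
    simpa only [Finset.mem_compl, Finset.mem_union, not_or] using (e₂.symm a).2
  let φ : Fin s ⊕ (Fin m ⊕ Fin t) → V :=
    Sum.elim (fun a => e₁.symm a) (Sum.elim (fun a => e₂.symm a) fun a => e₃.symm a)
  have hφ : Function.Injective φ := by
    refine (Subtype.val_injective.comp e₁.symm.injective).sumElim
      ((Subtype.val_injective.comp e₂.symm.injective).sumElim
        (Subtype.val_injective.comp e₃.symm.injective) fun a c =>
          (ne_of_mem_of_not_mem (e₃.symm c).2 (hmem₂ a).2).symm) ?_
    rintro a (c | c)
    exacts [ne_of_mem_of_not_mem (e₁.symm a).2 (hmem₂ c).1,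
      hZ.forall_ne_finset (e₁.symm a).2 (e₃.symm c).2]
  have hbij : Function.Bijective φ := by
    refine (Fintype.bijective_iff_injective_and_card φ).2 ⟨hφ, ?_⟩
    simpa using hcard.symm
  exact ⟨Equiv.ofBijective φ hbij, fun a => (e₁.symm a).2, hmem₂, fun a => (e₃.symm a).2⟩

theorem nonempty_iso_joinGraph {V : Type*} [Fintype V] {G : SimpleGraph V} {s m t : ℕ}
    {S Z : Finset V} (hSZ : Disjoint S Z) (hS : S.card = s) (hZ : Z.card = t)
    (hcard : Fintype.card V = s + (m + t))
    (hadj : ∀ u v, G.Adj u v ↔ u ≠ v ∧ (u ∈ S ∨ v ∈ S ∨ (u ∉ Z ∧ v ∉ Z))) :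
    Nonempty (G ≃g joinGraph s m t) := by
  obtain ⟨e, h₁, h₂, h₃⟩ := exists_equiv_of_disjoint hSZ hS hZ hcard
  have h₃' : ∀ a, e (Sum.inr (Sum.inr a)) ∉ S := fun a => Finset.disjoint_right.1 hSZ (h₃ a)
  refine ⟨RelIso.symm ⟨e, ?_⟩⟩
  rintro (a | a | a) (c | c | c) <;> simp [hadj, joinGraph, graphJoin, h₁, h₂, h₃, h₃']

variable {V : Type*} [DecidableEq V]

/-- The weight that takes the value `A` on `Z₁`, `C` on `Z₃` and `B` elsewhere: the Perron vector
of a graph `K_s ∨ (K_m ∪ t K₁)` whose first and last blocks are placed on `Z₁` and `Z₃`. -/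
def blockWeight (Z₁ Z₃ : Finset V) (A B C : ℝ) (v : V) : ℝ :=
  if v ∈ Z₁ then A else if v ∈ Z₃ then C else B

theorem blockWeight_nonneg (Z₁ Z₃ : Finset V) {A B C : ℝ} (hA : 0 ≤ A) (hB : 0 ≤ B) (hC : 0 ≤ C)
    (v : V) : 0 ≤ blockWeight Z₁ Z₃ A B C v := by
  unfold blockWeight
  split_ifs <;> assumption

theorem sum_blockWeight {Z₁ Z₃ : Finset V} (hZ : Disjoint Z₁ Z₃) (A B C : ℝ) (Y : Finset V) :
    ∑ v ∈ Y, blockWeight Z₁ Z₃ A B C v =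
      (Y.card : ℝ) * B + ((Y ∩ Z₁).card : ℝ) * (A - B) + ((Y ∩ Z₃).card : ℝ) * (C - B) := by
  have hterm : ∀ v, blockWeight Z₁ Z₃ A B C v =
      B + (if v ∈ Z₁ then A - B else 0) + if v ∈ Z₃ then C - B else 0 := by
    intro v
    by_cases h₁ : v ∈ Z₁
    · simp [blockWeight, h₁, Finset.disjoint_left.1 hZ h₁]
    · by_cases h₃ : v ∈ Z₃ <;> simp [blockWeight, h₁, h₃]
  simp only [hterm, Finset.sum_add_distrib, Finset.sum_const, Finset.sum_ite_mem, nsmul_eq_mul]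

theorem exists_adjForm_compl_blockWeight_le [Fintype V] {G : SimpleGraph V} (hG : G.Connected)
    {s m t : ℕ} (hs : 0 < s) (ht : 0 < t) (hcard : Fintype.card V = s + (m + t))
    (hμ : distSpectralRadius G ≤ distSpectralRadius (joinGraph s m t)) :
    ∃ A B C : ℝ, 0 < A ∧ A < B ∧ 0 < C ∧ C ≤ 2 * A ∧
      ∀ Z₁ Z₃ : Finset V, Disjoint Z₁ Z₃ → Z₁.card = s → Z₃.card = t →
        adjForm Gᶜ (blockWeight Z₁ Z₃ A B C) ≤ 2 * t * m * (B * C) + t * (t - 1) * C ^ 2 := by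
  obtain ⟨A, B, C, hA, hAB, hC, hCA, hx⟩ := exists_joinGraph_eigenvector (m := m) hs ht
  refine ⟨A, B, C, hA, hAB, hC, hCA, fun Z₁ Z₃ hZ h₁ h₃ => ?_⟩
  obtain ⟨e, he₁, he₂, he₃⟩ := exists_equiv_of_disjoint hZ h₁ h₃ hcard
  have hw : blockWeight Z₁ Z₃ A B C =
      Sum.elim (fun _ => A) (Sum.elim (fun _ => B) fun _ => C) ∘ e.symm := by
    rw [← Equiv.comp_symm_eq, Equiv.symm_symm]
    have he₃' : ∀ a, e (Sum.inr (Sum.inr a)) ∉ Z₁ := fun a => Finset.disjoint_right.1 hZ (he₃ a)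
    ext (a | a | a) <;> simp [blockWeight, he₁, he₂, he₃, he₃']
  rw [hw, ← adjForm_compl_joinGraph]
  refine adjForm_compl_comp_equiv_le hG (joinGraph_connected hs) (joinGraph_dist_le_two hs) hμ
    e.symm ?_ hx
  rintro (_ | _ | _)
  exacts [hA.le, (hA.trans hAB).le, hC.le]

end Blocks

section Separation

variable {V ι κ : Type*} {G : SimpleGraph V} {S : Finset V} {f : V → ι}

/-- `f` labels the vertices outside `S` so that `G - S` is constant on components and every label
occurs: deleting `S` leaves at least as many components as there are labels. The values of `f` on
`S` are irrelevant. -/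
structure IsSeparation (G : SimpleGraph V) (S : Finset V) (f : V → ι) : Prop where
  eq_of_adj : ∀ u ∉ S, ∀ v ∉ S, G.Adj u v → f u = f v
  exists_eq : ∀ l, ∃ v ∉ S, f v = l

namespace IsSeparation

theorem comp (h : IsSeparation G S f) {g : ι → κ} (hg : Function.Surjective g) :
    IsSeparation G S (g ∘ f) where
  eq_of_adj u hu v hv huv := congrArg g (h.eq_of_adj u hu v hv huv)
  exists_eq l := by
    obtain ⟨i, rfl⟩ := hg l
    obtain ⟨v, hv, rfl⟩ := h.exists_eq i
    exact ⟨v, hv, rfl⟩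

theorem exists_fin [Finite ι] (h : IsSeparation G S f) {N : ℕ} [NeZero N] (hN : N ≤ Nat.card ι) :
    ∃ g : V → Fin N, IsSeparation G S g := by
  have := Fintype.ofFinite ι
  obtain ⟨e⟩ : Nonempty (Fin N ↪ ι) := by
    rw [Function.Embedding.nonempty_iff_card_le, Fintype.card_fin, ← Nat.card_eq_fintype_card]
    exact hN
  exact ⟨_, h.comp (Function.invFun_surjective e.injective)⟩

theorem of_induce [Nonempty ι] [DecidableEq V] {X : Finset V} {T : Finset {v : V | v ∉ X}}
    {g : {v : V | v ∉ X} → ι} (h : IsSeparation (G.induce {v : V | v ∉ X}) T g) :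
    ∃ f : V → ι, IsSeparation G (X ∪ T.map (Function.Embedding.subtype _)) f := by
  obtain ⟨l₀⟩ := ‹Nonempty ι›
  refine ⟨fun v => if hv : v ∉ X then g ⟨v, hv⟩ else l₀, ⟨fun u hu v hv huv => ?_, fun l => ?_⟩⟩
  · have hmem : ∀ w ∉ X ∪ T.map (Function.Embedding.subtype _),
        ∃ hw : w ∉ X, (⟨w, hw⟩ : {v : V | v ∉ X}) ∉ T := fun w hw =>
      ⟨fun h => hw (Finset.mem_union_left _ h), fun h =>
        hw (Finset.mem_union_right _ (Finset.mem_map_of_mem (Function.Embedding.subtype _) h))⟩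
    obtain ⟨huX, huT⟩ := hmem u hu
    obtain ⟨hvX, hvT⟩ := hmem v hv
    simpa only [dif_pos huX, dif_pos hvX] using h.eq_of_adj _ huT _ hvT huv
  · obtain ⟨⟨v, hvX⟩, hvT, rfl⟩ := h.exists_eq l
    refine ⟨v, ?_, dif_pos hvX⟩
    simpa [show v ∉ X from hvX] using hvT

theorem eq_of_reachable (h : IsSeparation G S f) {u v : {v : V | v ∉ S}}
    (huv : (G.induce {v : V | v ∉ S}).Reachable u v) : f u = f v := by
  obtain ⟨p⟩ := huv
  induction p with
  | nil => rfl
  | @cons a c _ hac _ ih => exact (h.eq_of_adj a a.2 c c.2 hac).trans ih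

end IsSeparation

theorem IsKConnected.connected [Fintype V] {k : ℕ} (hG : IsKConnected G k) (hk : 0 < k) :
    G.Connected := by
  have h := hG.2 ∅ (by simpa using hk)
  have huniv : {v : V | v ∉ (∅ : Finset V)} = Set.univ := by simp
  rw [huniv] at h
  exact (SimpleGraph.induceUnivIso G).connected_iff.1 h

theorem IsKConnected.le_card_of_isSeparation [Fintype V] [Nontrivial ι] {k : ℕ}
    (hG : IsKConnected G k) (h : IsSeparation G S f) : k ≤ S.card := by
  by_contra! hS
  obtain ⟨i, j, hij⟩ := exists_pair_ne ι
  obtain ⟨u, hu, rfl⟩ := h.exists_eq i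
  obtain ⟨v, hv, rfl⟩ := h.exists_eq j
  exact hij (h.eq_of_reachable ((hG.2 S hS).preconnected ⟨u, hu⟩ ⟨v, hv⟩))

theorem IsKConnected.le_minDegree [Fintype V] [DecidableRel G.Adj] {k : ℕ}
    (hG : IsKConnected G k) : k ≤ G.minDegree := by
  classical
  by_contra! hlt
  have : Nonempty V := Fintype.card_pos_iff.1 (Nat.zero_lt_of_lt hG.1)
  obtain ⟨v, hv⟩ := G.exists_minimal_degree_vertex
  have hcard : (G.neighborFinset v).card < k := by
    rwa [SimpleGraph.card_neighborFinset_eq_degree, ← hv]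
  have hvN : v ∉ G.neighborFinset v := by simp
  obtain ⟨w, hw⟩ : ∃ w, w ∉ insert v (G.neighborFinset v) := by
    refine (Finset.exists_mem_notMem_of_card_lt_card (?_ : _ < Finset.univ.card)).imp
      fun _ h => h.2
    rw [Finset.card_insert_of_notMem hvN, Finset.card_univ]
    have := hG.1
    omega
  rw [Finset.mem_insert, not_or] at hw
  have hsep : IsSeparation G (G.neighborFinset v) (· = v) := by
    refine ⟨fun a ha c hc hac => ?_, fun p => ?_⟩
    · have ha' : a ≠ v := fun h => hc (by simpa [h] using hac)
      have hc' : c ≠ v := fun h => ha (by simpa [h] using hac.symm)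
      simp [ha', hc']
    · by_cases hp : p
      · exact ⟨v, hvN, by simp [hp]⟩
      · exact ⟨w, hw.2, by simp [hp, hw.1]⟩
  exact (hG.le_card_of_isSeparation hsep).not_gt hcard

end Separation

section OddFactor

open Finset

theorem hasOddFactor_of_multiplicity {V : Type*} [Fintype V] {G : SimpleGraph V} {b : ℕ}
    (hb : Odd b) (c : V → V → ℕ) (hsymm : ∀ u v, c u v = c v u) (heven : ∀ u, Even (c u u))
    (hsum : ∀ u, ∑ v, c u v = b) (hadj : ∀ u v, 0 < c u v → u = v ∨ G.Adj u v) :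
    HasOddFactor G b := by
  classical
  let H : SimpleGraph V :=
    { Adj := fun u v => u ≠ v ∧ Odd (c u v)
      symm := ⟨fun u v h => ⟨h.1.symm, hsymm u v ▸ h.2⟩⟩
      loopless := ⟨fun _ h => h.1 rfl⟩ }
  refine ⟨H, fun u v h => (hadj u v h.2.pos).resolve_left h.1, fun u => ?_⟩
  have hset : H.neighborSet u = ({v ∈ univ.erase u | Odd (c u v)} : Finset V) := by
    ext v
    simp [H, SimpleGraph.mem_neighborSet, ne_comm]
  have hdeg : ∑ v ∈ univ.erase u, c u v + c u u = b := by
    rw [sum_erase_add _ _ (mem_univ u), hsum]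
  rw [hset, Set.ncard_coe_finset]
  constructor
  · rw [← odd_sum_iff_odd_card_odd]
    exact (Nat.odd_add.1 (hdeg ▸ hb)).2 (heven u)
  · calc #{v ∈ univ.erase u | Odd (c u v)}
        = ∑ v ∈ univ.erase u with Odd (c u v), 1 := card_eq_sum_ones _
      _ ≤ ∑ v ∈ univ.erase u with Odd (c u v), c u v :=
          sum_le_sum fun v hv => (mem_filter.1 hv).2.pos
      _ ≤ ∑ v ∈ univ.erase u, c u v := sum_le_sum_of_subset (filter_subset _ _)
      _ ≤ b := by omega

/-- The blow-up of `G` in which every vertex becomes a clique on `b` vertices and every edge a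
complete bipartite graph. -/
def cliqueBlowup {V : Type*} (G : SimpleGraph V) (b : ℕ) : SimpleGraph (V × Fin b) where
  Adj p q := p ≠ q ∧ (p.1 = q.1 ∨ G.Adj p.1 q.1)
  symm := ⟨fun _ _ h => ⟨h.1.symm, h.2.imp Eq.symm fun h => h.symm⟩⟩
  loopless := ⟨fun _ h => h.1 rfl⟩

variable {V : Type*} {G : SimpleGraph V} {b : ℕ}

theorem hasOddFactor_of_isPerfectMatching_cliqueBlowup [Finite V] (hb : Odd b)
    {M : (cliqueBlowup G b).Subgraph} (hM : M.IsPerfectMatching) : HasOddFactor G b := by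
  classical
  have := Fintype.ofFinite V
  choose f hf hfu using SimpleGraph.Subgraph.isPerfectMatching_iff.1 hM
  have hff : ∀ p, f (f p) = p := fun p => (hfu (f p) p (hf p).symm).symm
  have hfne : ∀ p, f p ≠ p := fun p => (M.adj_sub (hf p)).1.symm
  let c : V → V → ℕ := fun u v => #{p | p.1 = u ∧ (f p).1 = v}
  refine hasOddFactor_of_multiplicity hb c (fun u v => ?_) (fun u => ?_) (fun u => ?_) ?_
  · exact card_nbij' f f (fun p => by simp [hff, and_comm]) (fun p => by simp [hff, and_comm])
      (fun p _ => hff p) fun p _ => hff p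
  · have h : ∑ p with p.1 = u ∧ (f p).1 = u, (1 : ZMod 2) = 0 :=
      sum_involution (fun p _ => f p) (fun _ _ => by decide) (fun p _ _ => hfne p)
        (by simp [hff, and_comm]) (fun p _ => hff p)
    rwa [sum_const, nsmul_one, ZMod.natCast_eq_zero_iff_even] at h
  · have hfib : #{p : V × Fin b | p.1 = u} = b := by
      have : ({p : V × Fin b | p.1 = u} : Finset _) = {u} ×ˢ univ := by
        ext ⟨v, i⟩
        simp [eq_comm]
      rw [this, card_product, card_singleton, one_mul, card_univ, Fintype.card_fin]
    have h := card_eq_sum_card_fiberwise (s := ({p | p.1 = u} : Finset (V × Fin b)))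
      (t := univ) (f := fun p => (f p).1) (fun _ _ => mem_univ _)
    simp only [filter_filter] at h
    exact h.symm.trans hfib
  · intro u v h
    obtain ⟨p, hp⟩ := card_pos.1 h
    obtain ⟨-, rfl, rfl⟩ := mem_filter.1 hp
    exact (M.adj_sub (hf p)).2

theorem exists_isSeparation_of_forall_not_isPerfectMatching [Fintype V]
    (hV : Even (Fintype.card V))
    (h : ∀ M : G.Subgraph, ¬ M.IsPerfectMatching) :
    ∃ (U : Finset V) (f : V → Fin (#U + 2)), IsSeparation G U f := by
  classical
  obtain ⟨W, hW⟩ := SimpleGraph.exists_isTutteViolator h (by simpa using hV)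
  obtain ⟨U, rfl⟩ : ∃ U : Finset V, W = U := ⟨W.toFinset, W.coe_toFinset.symm⟩
  rw [SimpleGraph.IsTutteViolator, Set.ncard_coe_finset] at hW
  set G' := (⊤ : G.Subgraph).deleteVerts U
  have hmem : ∀ v, v ∈ G'.verts ↔ v ∉ U := by simp [G']
  have hcard : #U + 2 ≤ Nat.card G'.coe.ConnectedComponent := by
    have hverts : Nat.card G'.verts + #U = Fintype.card V := by
      have : G'.verts = (↑U)ᶜ := Set.ext hmem
      rw [this, Nat.card_coe_set_eq, add_comm, ← Set.ncard_coe_finset,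
        Set.ncard_add_ncard_compl, Nat.card_eq_fintype_card]
    have hodd := G'.coe.odd_ncard_oddComponents
    have hle : G'.coe.oddComponents.ncard ≤ Nat.card G'.coe.ConnectedComponent :=
      Set.ncard_le_card _
    rw [Nat.odd_iff, Nat.odd_iff] at hodd
    rw [Nat.even_iff] at hV
    omega
  obtain ⟨c₀⟩ : Nonempty G'.coe.ConnectedComponent := (Nat.card_pos_iff.1 (by omega)).1
  let f : V → G'.coe.ConnectedComponent := fun v =>
    if hv : v ∈ G'.verts then G'.coe.connectedComponentMk ⟨v, hv⟩ else c₀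
  have hf : IsSeparation G U f := by
    refine ⟨fun u hu v hv huv => ?_, fun c => ?_⟩
    · simp only [f, dif_pos ((hmem u).2 hu), dif_pos ((hmem v).2 hv)]
      refine SimpleGraph.ConnectedComponent.sound (SimpleGraph.Adj.reachable ?_)
      simpa [G', hu, hv] using huv
    · obtain ⟨⟨v, hv⟩, rfl⟩ := c.exists_rep
      exact ⟨v, (hmem v).1 hv, dif_pos hv⟩
  exact ⟨U, hf.exists_fin hcard⟩

theorem IsSeparation.exists_of_cliqueBlowup {ι : Type*} (hb : 0 < b) {U : Finset (V × Fin b)}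
    {f : V × Fin b → ι} (h : IsSeparation (cliqueBlowup G b) U f) :
    ∃ (S : Finset V) (g : V → ι), b * #S ≤ #U ∧ IsSeparation G S g := by
  classical
  let S : Finset V := {v ∈ U.image Prod.fst | ∀ i, (v, i) ∈ U}
  have hS : ∀ v i, (v, i) ∉ U → v ∉ S := fun v i hi hv => hi ((mem_filter.1 hv).2 i)
  have hrep : ∀ v ∉ S, ∃ i, (v, i) ∉ U := by
    intro v hv
    by_contra! hU
    exact hv (mem_filter.2 ⟨mem_image_of_mem _ (hU ⟨0, hb⟩), hU⟩)
  have : Nonempty (Fin b) := ⟨⟨0, hb⟩⟩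
  choose! r hr using hrep
  have heq : ∀ p ∉ U, ∀ q ∉ U, (p.1 = q.1 ∨ G.Adj p.1 q.1) → f p = f q := by
    intro p hp q hq hpq
    obtain rfl | hne := eq_or_ne p q
    exacts [rfl, h.eq_of_adj p hp q hq ⟨hne, hpq⟩]
  refine ⟨S, fun v => f (v, r v), ?_, fun u hu v hv huv => ?_, fun l => ?_⟩
  · have hsub : S ×ˢ (univ : Finset (Fin b)) ⊆ U := fun p hp =>
      (mem_filter.1 (mem_product.1 hp).1).2 p.2
    simpa [mul_comm] using card_le_card hsub
  · exact heq _ (hr u hu) _ (hr v hv) (Or.inr huv)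
  · obtain ⟨p, hp, rfl⟩ := h.exists_eq l
    have hpS := hS p.1 p.2 hp
    exact ⟨p.1, hpS, heq _ (hr _ hpS) _ hp (Or.inl rfl)⟩

theorem exists_isSeparation_of_not_hasOddFactor [Fintype V] (hb : Odd b)
    (hV : Even (Fintype.card V)) (hG : ¬ HasOddFactor G b) :
    ∃ (S : Finset V) (f : V → Fin (b * #S + 2)), IsSeparation G S f := by
  obtain ⟨U, f, hf⟩ := exists_isSeparation_of_forall_not_isPerfectMatching
    (G := cliqueBlowup G b) (by simpa using hV.mul_right b)
    fun M hM => hG (hasOddFactor_of_isPerfectMatching_cliqueBlowup hb hM)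
  obtain ⟨S, g, hS, hg⟩ := hf.exists_of_cliqueBlowup hb.pos
  exact ⟨S, hg.exists_fin (by simpa using hS)⟩

theorem exists_isSeparation_of_not_isKCriticalOddFactor [Fintype V] {k : ℕ} (hb : Odd b)
    (hk : k + 2 ≤ Fintype.card V) (hV : Fintype.card V ≡ k [MOD 2])
    (hG : ¬ IsKCriticalOddFactor G k b) :
    ∃ (S : Finset V) (r : ℕ) (f : V → Fin (b * r + 2)), #S = k + r ∧ IsSeparation G S f := by
  classical
  obtain ⟨X, hX, hno⟩ : ∃ X : Finset V, #X = k ∧ ¬ HasOddFactor (G.induce {v | v ∉ X}) b := by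
    by_contra! h
    exact hG ⟨hk, h⟩
  have hcard : Fintype.card {v : V | v ∉ X} = Fintype.card V - k := by
    rw [← hX, ← card_compl, ← Fintype.card_coe]
    exact Fintype.card_congr (Equiv.subtypeEquivRight fun v => by simp)
  have heven : Even (Fintype.card {v : V | v ∉ X}) := by
    rw [hcard, Nat.even_iff]
    have := hV
    rw [Nat.ModEq] at this
    omega
  obtain ⟨T, g, hg⟩ := exists_isSeparation_of_not_hasOddFactor hb heven hno
  obtain ⟨f, hf⟩ := hg.of_induce
  refine ⟨_, #T, f, ?_, hf⟩
  rw [card_union_of_disjoint, card_map, hX]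
  refine disjoint_right.2 fun v hv => ?_
  obtain ⟨w, -, rfl⟩ := mem_map.1 hv
  exact w.2

end OddFactor

section CrossGraph

open Finset

variable {V ι : Type*}

/-- The complete multipartite graph on the vertices outside `S` whose parts are the fibres of `f`;
the vertices in `S` are isolated. -/
def crossGraph (S : Finset V) (f : V → ι) : SimpleGraph V where
  Adj u v := u ∉ S ∧ v ∉ S ∧ f u ≠ f v
  symm := ⟨fun _ _ h => ⟨h.2.1, h.1, h.2.2.symm⟩⟩
  loopless := ⟨fun _ h => h.2.2 rfl⟩

theorem IsSeparation.crossGraph_le_compl {G : SimpleGraph V} {S : Finset V} {f : V → ι}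
    (h : IsSeparation G S f) : crossGraph S f ≤ Gᶜ := fun u v huv =>
  ⟨fun huv' => huv.2.2 (congrArg f huv'), fun hadj => huv.2.2 (h.eq_of_adj u huv.1 v huv.2.1 hadj)⟩

variable [Fintype V] [DecidableEq V] [DecidableEq ι] {G : SimpleGraph V} {S : Finset V} {f : V → ι}

/-- The vertices outside `S` with label `l`. -/
def part (S : Finset V) (f : V → ι) (l : ι) : Finset V := {v ∈ Sᶜ | f v = l}

@[simp]
theorem mem_part {l : ι} {v : V} : v ∈ part S f l ↔ v ∉ S ∧ f v = l := by
  simp [part]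

theorem sum_sum_part [Fintype ι] (S : Finset V) (f : V → ι) (x : V → ℝ) :
    ∑ l, ∑ v ∈ part S f l, x v = ∑ v ∈ Sᶜ, x v :=
  sum_fiberwise _ _ _

theorem sum_card_part [Fintype ι] (S : Finset V) (f : V → ι) : ∑ l, #(part S f l) = #Sᶜ :=
  (card_eq_sum_card_fiberwise fun _ _ => mem_univ _).symm

theorem adjForm_crossGraph [Fintype ι] (S : Finset V) (f : V → ι) (x : V → ℝ) :
    adjForm (crossGraph S f) x =
      (∑ v ∈ Sᶜ, x v) ^ 2 - ∑ l, (∑ v ∈ part S f l, x v) ^ 2 := by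
  classical
  have hparts : ∑ l, (∑ v ∈ part S f l, x v) ^ 2 =
      ∑ u ∈ Sᶜ, ∑ v ∈ Sᶜ, if f u = f v then x u * x v else 0 := by
    rw [← sum_fiberwise Sᶜ f]
    refine sum_congr rfl fun l _ => ?_
    rw [sq, sum_mul_sum]
    refine sum_congr rfl fun u hu => ?_
    rw [(mem_filter.1 hu).2, part, sum_filter]
    exact sum_congr rfl fun v _ => by simp only [eq_comm]
  rw [adjForm_eq_sum, hparts, sq, sum_mul_sum, ← sum_sub_distrib, ← sum_subset (subset_univ Sᶜ)]
  · refine sum_congr rfl fun u hu => ?_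
    rw [← sum_sub_distrib, ← sum_subset (subset_univ Sᶜ)]
    · refine sum_congr rfl fun v hv => ?_
      rw [mem_compl] at hu hv
      by_cases h : f u = f v <;> simp [crossGraph, hu, hv, h]
    · exact fun v _ hv => if_neg fun h => hv (mem_compl.2 h.2.1)
  · exact fun u _ hu => sum_eq_zero fun v _ => if_neg fun h => hu (mem_compl.2 h.1)

namespace IsSeparation

theorem part_nonempty (h : IsSeparation G S f) (l : ι) : (part S f l).Nonempty := by
  obtain ⟨v, hv⟩ := h.exists_eq l
  exact ⟨v, mem_part.2 hv⟩

theorem minDegree_lt_card_add_card_part [DecidableRel G.Adj] (h : IsSeparation G S f) (l : ι) :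
    G.minDegree < #S + #(part S f l) := by
  obtain ⟨v, hv⟩ := h.part_nonempty l
  obtain ⟨hvS, rfl⟩ := mem_part.1 hv
  have hsub : insert v (G.neighborFinset v) ⊆ S ∪ part S f (f v) := by
    refine insert_subset (mem_union_right _ hv) fun w hw => ?_
    by_cases hwS : w ∈ S
    · exact mem_union_left _ hwS
    · have hvw := h.eq_of_adj v hvS w hwS (by simpa using hw)
      exact mem_union_right _ (mem_part.2 ⟨hwS, hvw.symm⟩)
  calc G.minDegree ≤ #(G.neighborFinset v) := by
        simpa using G.minDegree_le_degree v
    _ < #(insert v (G.neighborFinset v)) := by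
        rw [card_insert_of_notMem (by simp)]
        exact Nat.lt_succ_self _
    _ ≤ #(S ∪ part S f (f v)) := card_le_card hsub
    _ ≤ #S + #(part S f (f v)) := card_union_le _ _

end IsSeparation

end CrossGraph

section SmallSeparator

open Finset

variable {V : Type*} [Fintype V] [DecidableEq V] {G : SimpleGraph V} {S : Finset V}

theorem IsSeparation.two_mul_sum_part_mul_sum_part_le {f : V → Bool} (h : IsSeparation G S f)
    {x : V → ℝ} (hx : 0 ≤ x) :
    2 * (∑ v ∈ part S f true, x v) * ∑ v ∈ part S f false, x v ≤ adjForm Gᶜ x := by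
  refine le_trans (le_of_eq ?_) (adjForm_mono h.crossGraph_le_compl hx)
  rw [adjForm_crossGraph, ← sum_sum_part S f, Fintype.sum_bool, Fintype.sum_bool]
  ring

theorem two_sides_weight_lt {A B C : ℝ} (hA : 0 < A) (hAB : A ≤ B) (hC : 0 ≤ C) (hCA : C ≤ 2 * A)
    {p h j t : ℕ} (hj : 0 < j) (hp : 2 * t < p) (hph : 2 * t ^ 2 ≤ p + h) :
    2 * t * (p + h) * (B * C) + t * (t - 1) * C ^ 2 < 2 * (p * B) * (j * A + t * C + h * B) := by
  have hB : 0 < B := hA.trans_le hAB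
  have hp' : (2 * t + 1 : ℝ) ≤ p := by exact_mod_cast hp
  have hph' : (2 * t ^ 2 : ℝ) ≤ p + h := by exact_mod_cast hph
  have hcount : (2 * (t * (t - 1)) : ℝ) < p * j + h := by
    have hj' : (1 : ℝ) ≤ j := by exact_mod_cast hj
    have hpj : (p : ℝ) ≤ p * j := le_mul_of_one_le_right p.cast_nonneg hj'
    have ht : (0 : ℝ) ≤ t := t.cast_nonneg
    rcases ht.eq_or_lt with ht | ht <;> nlinarith
  have htt : (0 : ℝ) ≤ t * (t - 1) := by
    rcases t.eq_zero_or_pos with rfl | ht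
    · simp
    · exact mul_nonneg t.cast_nonneg (sub_nonneg.2 (by exact_mod_cast ht))
  have hsq : C ^ 2 ≤ 4 * (A * B) := by nlinarith
  have hBC : (t * h : ℝ) * (B * C) ≤ (t * h) * (2 * B ^ 2) :=
    mul_le_mul_of_nonneg_left (by nlinarith) (by positivity)
  have hBB : (h : ℝ) * (A * B) ≤ (p - 2 * t) * (h * B ^ 2) := by
    have : (h : ℝ) * (A * B) ≤ h * B ^ 2 := by gcongr; nlinarith
    nlinarith [mul_nonneg (h.cast_nonneg : (0 : ℝ) ≤ h) (sq_nonneg B)]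
  have hgain := mul_lt_mul_of_pos_right hcount (mul_pos hA hB)
  nlinarith [mul_le_mul_of_nonneg_left hsq htt]

theorem IsSeparation.exists_lt_adjForm_compl {f : V → Bool} (hf : IsSeparation G S f)
    {A B C : ℝ} (hA : 0 < A) (hAB : A ≤ B) (hC : 0 ≤ C) (hCA : C ≤ 2 * A) {s m t j : ℕ}
    (hcard : Fintype.card V = s + (m + t)) (hj : 0 < j) (hS : #S + j = s)
    (hfalse : t + j ≤ #(part S f false))
    (htrue : 2 * t < #(part S f true)) (hm : 2 * t ^ 2 ≤ m) :
    ∃ Z₁ Z₃ : Finset V, Disjoint Z₁ Z₃ ∧ #Z₁ = s ∧ #Z₃ = t ∧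
      2 * t * m * (B * C) + t * (t - 1) * C ^ 2 < adjForm Gᶜ (blockWeight Z₁ Z₃ A B C) := by
  let P := part S f true
  let R := part S f false
  have hPS : Disjoint P S := disjoint_left.2 fun v hv => (mem_part.1 hv).1
  have hRS : Disjoint R S := disjoint_left.2 fun v hv => (mem_part.1 hv).1
  have hPR : Disjoint P R := disjoint_left.2 fun v hv hv' =>
    absurd ((mem_part.1 hv).2.symm.trans (mem_part.1 hv').2) (by simp)
  obtain ⟨Z, hZR, hZ⟩ := exists_subset_card_eq (s := R) (n := t) (le_of_add_le_left hfalse)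
  obtain ⟨J, hJR, hJ⟩ := exists_subset_card_eq (s := R \ Z) (n := j)
    (by rw [card_sdiff_of_subset hZR, hZ]; exact Nat.le_sub_of_add_le' hfalse)
  have hJZ : Disjoint J Z := disjoint_sdiff_self_left.mono_left hJR
  replace hJR := hJR.trans sdiff_subset
  have hdisj : Disjoint (S ∪ J) Z := disjoint_union_left.2 ⟨hRS.symm.mono_right hZR, hJZ⟩
  obtain ⟨h, hh⟩ : ∃ h, #R = t + j + h := Nat.exists_eq_add_of_le hfalse
  have hmP : m = #P + h := by
    have hsum : #P + #R = s + (m + t) - #S := by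
      rw [← hcard, ← card_compl, ← sum_card_part S f, Fintype.sum_bool]
    omega
  have hPw : ∑ v ∈ P, blockWeight (S ∪ J) Z A B C v = #P * B := by
    rw [sum_blockWeight hdisj, inter_union_distrib_left, disjoint_iff_inter_eq_empty.1 hPS,
      disjoint_iff_inter_eq_empty.1 (hPR.mono_right hJR),
      disjoint_iff_inter_eq_empty.1 (hPR.mono_right hZR)]
    simp
  have hRw : ∑ v ∈ R, blockWeight (S ∪ J) Z A B C v = j * A + t * C + h * B := by
    rw [sum_blockWeight hdisj, inter_union_distrib_left, disjoint_iff_inter_eq_empty.1 hRS,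
      empty_union, inter_eq_right.2 hJR, inter_eq_right.2 hZR, hJ, hZ, hh]
    push_cast
    ring
  refine ⟨S ∪ J, Z, hdisj, ?_, hZ, ?_⟩
  · rw [card_union_of_disjoint (hRS.symm.mono_right hJR), hJ, hS]
  · calc 2 * t * m * (B * C) + t * (t - 1) * C ^ 2
        = 2 * t * (#P + h) * (B * C) + t * (t - 1) * C ^ 2 := by rw [hmP, Nat.cast_add]
      _ < 2 * (#P * B) * (j * A + t * C + h * B) :=
          two_sides_weight_lt hA hAB hC hCA hj htrue (hmP ▸ hm)
      _ ≤ adjForm Gᶜ (blockWeight (S ∪ J) Z A B C) := by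
          rw [← hPw, ← hRw]
          exact hf.two_mul_sum_part_mul_sum_part_le
            (blockWeight_nonneg _ _ hA.le (hA.le.trans hAB) hC)

theorem IsSeparation.exists_bool {N : ℕ} {f : V → Fin (N + 2)} (hf : IsSeparation G S f) {c : ℕ}
    (hc : ∀ l, c ≤ #(part S f l)) :
    ∃ g : V → Bool, IsSeparation G S g ∧ #Sᶜ ≤ (N + 2) * #(part S g true) ∧
      (N + 1) * c ≤ #(part S g false) := by
  obtain ⟨l₀, -, hmax⟩ := exists_max_image univ (fun l => #(part S f l)) univ_nonempty
  have hsurj : Function.Surjective fun l => decide (l = l₀) := by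
    rintro (_ | _)
    · obtain ⟨l, hl⟩ := exists_ne l₀
      exact ⟨l, decide_eq_false hl⟩
    · exact ⟨l₀, decide_eq_true rfl⟩
  have htrue : part S ((fun l => decide (l = l₀)) ∘ f) true = part S f l₀ := by
    ext v
    simp
  refine ⟨_, hf.comp hsurj, ?_, ?_⟩
  · rw [htrue, ← sum_card_part S f]
    simpa using sum_le_card_nsmul univ (fun l => #(part S f l)) _ hmax
  · have hsum := sum_card_part S ((fun l => decide (l = l₀)) ∘ f)
    rw [Fintype.sum_bool, htrue, ← sum_card_part S f, ← add_sum_erase _ _ (mem_univ l₀),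
      Nat.add_left_cancel_iff] at hsum
    have hle := card_nsmul_le_sum (univ.erase l₀) (fun l => #(part S f l)) c fun l _ => hc l
    rw [hsum]
    simpa using hle

end SmallSeparator

section LargeSeparator

open Finset

-- Merging step: class `l ∈ L` keeps one vertex, of weight `c l`, and its other `e l` vertices, of
-- weight `B`, move to the largest class.
theorem sum_sq_add_mul_le {ι : Type*} {L : Finset ι} {e : ι → ℕ} {c : ι → ℝ} {B D : ℝ} {p : ℕ}
    (hB : 0 ≤ B) (hc : ∀ l ∈ L, c l ≤ D) (hp : ∀ l ∈ L, e l + 1 ≤ p) :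
    ∑ l ∈ L, (c l + e l * B) ^ 2 + (p * B) ^ 2 + 2 * B * (2 * B - D) * ∑ l ∈ L, (e l : ℝ) ≤
      ∑ l ∈ L, c l ^ 2 + ((p + ∑ l ∈ L, (e l : ℝ)) * B) ^ 2 := by
  set E := ∑ l ∈ L, (e l : ℝ) with hE
  have hterm : ∀ l ∈ L, (c l + e l * B) ^ 2 + 2 * B * (2 * B - D) * e l ≤
      c l ^ 2 + e l * ((2 * p + E) * B ^ 2) := by
    intro l hl
    rcases (e l).eq_zero_or_pos with he | he
    · simp [he]
    have he' : (1 : ℝ) ≤ e l := by exact_mod_cast he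
    have hep : (e l + 1 : ℝ) ≤ p := by exact_mod_cast hp l hl
    have heE : (e l : ℝ) ≤ E := single_le_sum (fun i _ => (e i).cast_nonneg (α := ℝ)) hl
    have hlin : 2 * c l + e l * B + 2 * (2 * B - D) ≤ (2 * p + E) * B := by
      nlinarith [hc l hl]
    nlinarith [mul_le_mul_of_nonneg_left hlin (mul_nonneg (zero_le_one.trans he') hB)]
  have hsum := sum_le_sum hterm
  rw [sum_add_distrib, sum_add_distrib, ← mul_sum, ← sum_mul, ← hE] at hsum
  linear_combination hsum

variable {V ι : Type*} [Fintype V] [DecidableEq V] [DecidableEq ι]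
  {G : SimpleGraph V} {S : Finset V} {f : V → ι}

theorem disjoint_image_of_forall_mem_part {Z : Finset V} (hZ : Z ⊆ S) {r : ι → V}
    (hr : ∀ l, r l ∈ part S f l) (T : Finset ι) : Disjoint Z (T.image r) :=
  disjoint_right.2 fun v hv hvZ => by
    obtain ⟨l, -, rfl⟩ := mem_image.1 hv
    exact (mem_part.1 (hr l)).1 (hZ hvZ)

theorem sum_part_blockWeight {Z : Finset V} (hZ : Z ⊆ S) {r : ι → V} (hr : ∀ l, r l ∈ part S f l)
    (T : Finset ι) (A B C : ℝ) (l : ι) :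
    ∑ v ∈ part S f l, blockWeight Z (T.image r) A B C v =
      (if l ∈ T then C else B) + (#(part S f l) - 1 : ℕ) * B := by
  have hpart : Disjoint (part S f l) Z :=
    disjoint_left.2 fun v hv hvZ => (mem_part.1 hv).1 (hZ hvZ)
  have hinter : part S f l ∩ T.image r = if l ∈ T then {r l} else ∅ := by
    have hmem : ∀ l', r l' ∈ part S f l ↔ l' = l := fun l' => by
      have := mem_part.1 (hr l')
      simp [this]
    ext v
    split_ifs with hl
    · simp only [mem_inter, mem_image, mem_singleton]
      constructor
      · rintro ⟨hv, l', -, rfl⟩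
        rw [(hmem l').1 hv]
      · rintro rfl
        exact ⟨hr l, l, hl, rfl⟩
    · simp only [mem_inter, mem_image, notMem_empty, iff_false]
      rintro ⟨hv, l', hl', rfl⟩
      exact hl ((hmem l').1 hv ▸ hl')
  rw [sum_blockWeight (disjoint_image_of_forall_mem_part hZ hr T),
    disjoint_iff_inter_eq_empty.1 hpart, hinter, Nat.cast_pred (card_pos.2 ⟨r l, hr l⟩)]
  split_ifs <;> simp only [card_singleton, card_empty] <;> push_cast <;> ring

variable [Fintype ι]

theorem le_adjForm_crossGraph_blockWeight {Z : Finset V} (hZ : Z ⊆ S) {r : ι → V}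
    (hr : ∀ l, r l ∈ part S f l) {T : Finset ι} {l₀ : ι} (hl₀ : l₀ ∉ T)
    (hmax : ∀ l, #(part S f l) ≤ #(part S f l₀)) {g m : ℕ} (hι : Fintype.card ι = #T + g + 1)
    (hm : #Sᶜ = #T + g + m) {B : ℝ} (hB : 0 ≤ B) (A C : ℝ) :
    #T * (#T - 1) * C ^ 2 + 2 * #T * (g + m) * (B * C) + g * (g - 1 + 2 * m) * B ^ 2 +
        2 * B * (2 * B - max B C) * (m - #(part S f l₀)) ≤
      adjForm (crossGraph S f) (blockWeight Z (T.image r) A B C) := by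
  have hL : #(univ.erase l₀) = #T + g := by
    rw [card_erase_of_mem (mem_univ _), card_univ, hι]
    rfl
  let e : ι → ℕ := fun l => #(part S f l) - 1
  have he : ∀ l, #(part S f l) = e l + 1 := fun l =>
    (Nat.sub_add_cancel (card_pos.2 ⟨r l, hr l⟩)).symm
  have hE : ∑ l ∈ univ.erase l₀, (e l : ℝ) = m - #(part S f l₀) := by
    have hsum := sum_card_part S f
    rw [← add_sum_erase _ _ (mem_univ l₀), hm] at hsum
    simp only [he (_ : ι), sum_add_distrib, sum_const, hL, smul_eq_mul, mul_one] at hsum ⊢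
    rw [← Nat.cast_sum, eq_sub_iff_add_eq]
    exact_mod_cast (by omega : ∑ l ∈ univ.erase l₀, e l + (e l₀ + 1) = m)
  have hTL : T ⊆ univ.erase l₀ := fun l hl => mem_erase.2 ⟨ne_of_mem_of_not_mem hl hl₀, mem_univ l⟩
  have hTsum : ∀ a b : ℝ, ∑ l ∈ univ.erase l₀, (if l ∈ T then a else b) = #T * a + g * b := by
    intro a b
    rw [sum_ite, filter_mem_eq_inter, inter_eq_right.2 hTL, filter_notMem_eq_sdiff, sum_const,
      sum_const, card_sdiff_of_subset hTL, hL, Nat.add_sub_cancel_left, nsmul_eq_mul,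
      nsmul_eq_mul]
  have hmerge := sum_sq_add_mul_le (L := univ.erase l₀) (e := e)
    (c := fun l => if l ∈ T then C else B) (D := max B C) hB
    (fun l _ => by split_ifs; exacts [le_max_right _ _, le_max_left _ _])
    (fun l _ => (he l).symm.trans_le (hmax l))
  simp only [ite_pow] at hmerge
  rw [hTsum, hE, add_sub_cancel] at hmerge
  have hl₀w : B + e l₀ * B = #(part S f l₀) * B := by
    rw [he l₀]
    push_cast
    ring
  rw [adjForm_crossGraph, ← sum_sum_part S f]
  simp only [sum_part_blockWeight hZ hr]
  rw [← add_sum_erase _ _ (mem_univ l₀), ← add_sum_erase univ (fun l => (_ : ℝ) ^ 2) (mem_univ l₀),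
    if_neg hl₀, sum_add_distrib, hTsum, ← sum_mul, hE, hl₀w]
  linear_combination hmerge

theorem IsSeparation.exists_le_adjForm_crossGraph (hf : IsSeparation G S f) {l₀ : ι}
    (hmax : ∀ l, #(part S f l) ≤ #(part S f l₀)) {s t g m : ℕ} (hS : s ≤ #S)
    (hι : Fintype.card ι = t + g + 1) (hm : #Sᶜ = t + g + m) {B : ℝ} (hB : 0 ≤ B) (A C : ℝ) :
    ∃ Z₁ Z₃ : Finset V, Disjoint Z₁ Z₃ ∧ #Z₁ = s ∧ #Z₃ = t ∧
      t * (t - 1) * C ^ 2 + 2 * t * (g + m) * (B * C) + g * (g - 1 + 2 * m) * B ^ 2 +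
          2 * B * (2 * B - max B C) * (m - #(part S f l₀)) ≤
        adjForm (crossGraph S f) (blockWeight Z₁ Z₃ A B C) := by
  choose r hr using hf.part_nonempty
  obtain ⟨Z, hZS, hZ⟩ := exists_subset_card_eq hS
  obtain ⟨T, hTL, rfl⟩ := exists_subset_card_eq (s := univ.erase l₀) (n := t)
    (by rw [card_erase_of_mem (mem_univ _), card_univ, hι]; omega)
  have hrinj : Function.Injective r := fun l l' h =>
    (mem_part.1 (hr l)).2.symm.trans ((congrArg f h).trans (mem_part.1 (hr l')).2)
  exact ⟨Z, T.image r, disjoint_image_of_forall_mem_part hZS hr T, hZ,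
    card_image_of_injective _ hrinj, le_adjForm_crossGraph_blockWeight hZS hr
      (fun h => notMem_erase _ _ (hTL h)) hmax hι hm hB A C⟩

end LargeSeparator

section Extremal

open Finset

variable {V : Type*} [Fintype V] [DecidableEq V] {G : SimpleGraph V} {S : Finset V}

theorem nonempty_iso_joinGraph_of_compl_eq_crossGraph {ι : Type*} [Fintype ι] [DecidableEq ι]
    {f : V → ι} (hf : IsSeparation G S f) (hG : Gᶜ = crossGraph S f) {l₀ : ι} {s m t : ℕ}
    (hS : #S = s) (hι : Fintype.card ι = t + 1) (hcard : Fintype.card V = s + (m + t))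
    (hl₀ : m ≤ #(part S f l₀)) : Nonempty (G ≃g joinGraph s m t) := by
  set Z : Finset V := Sᶜ \ part S f l₀ with hZdef
  have hmemZ : ∀ v, v ∈ Z ↔ v ∉ S ∧ f v ≠ l₀ := fun v => by
    simp only [hZdef, mem_sdiff, mem_compl, mem_part]
    tauto
  have hL : #(univ.erase l₀) = t := by
    rw [card_erase_of_mem (mem_univ _), card_univ, hι, Nat.add_sub_cancel]
  have hmaps : Set.MapsTo f Z (univ.erase l₀ : Finset ι) := fun v hv => by
    simpa using ((hmemZ v).1 hv).2
  have hsurj : Set.SurjOn f Z (univ.erase l₀ : Finset ι) := fun l hl => by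
    obtain ⟨v, hv, rfl⟩ := hf.exists_eq l
    exact ⟨v, (hmemZ v).2 ⟨hv, by simpa using hl⟩, rfl⟩
  have hZle : #Z ≤ t := by
    rw [card_sdiff_of_subset (show part S f l₀ ⊆ Sᶜ from filter_subset _ _), card_compl]
    omega
  have hinj : Set.InjOn f Z := injOn_of_surjOn_of_card_le f hmaps hsurj (hZle.trans_eq hL.symm)
  have hZ : #Z = t := hZle.antisymm (hL ▸ card_le_card_of_surjOn f hsurj)
  have hSZ : Disjoint S Z := disjoint_right.2 fun v hv => ((hmemZ v).1 hv).1
  refine nonempty_iso_joinGraph hSZ hS hZ hcard fun u v => ?_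
  have hadj : G.Adj u v ↔ u ≠ v ∧ ¬ (crossGraph S f).Adj u v := by
    rw [← hG, SimpleGraph.compl_adj]
    exact ⟨fun h => ⟨h.ne, fun h' => h'.2 h⟩, fun h => not_not.1 fun h' => h.2 ⟨h.1, h'⟩⟩
  rw [hadj]
  refine and_congr_right fun huv => ?_
  have hlabel : u ∉ S → v ∉ S → (f u = f v ↔ f u = l₀ ∧ f v = l₀) := fun hu hv => by
    refine ⟨fun h => ?_, fun h => h.1.trans h.2.symm⟩
    by_contra hne
    have hu₀ : f u ≠ l₀ := fun hu₀ => hne ⟨hu₀, h ▸ hu₀⟩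
    exact huv (hinj ((hmemZ u).2 ⟨hu, hu₀⟩) ((hmemZ v).2 ⟨hv, h ▸ hu₀⟩) h)
  simp only [hmemZ, crossGraph]
  tauto

theorem IsSeparation.card_part_add_card_le {ι : Type*} [Fintype ι] [DecidableEq ι] {f : V → ι}
    (hf : IsSeparation G S f) (l : ι) : #(part S f l) + Fintype.card ι ≤ #Sᶜ + 1 := by
  have hrest : #(univ.erase l) ≤ ∑ l' ∈ univ.erase l, #(part S f l') := by
    simpa using card_nsmul_le_sum (univ.erase l) (fun l' => #(part S f l')) 1
      fun l' _ => card_pos.2 (hf.part_nonempty l')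
  rw [← sum_card_part S f, ← add_sum_erase _ _ (mem_univ l), ← card_univ,
    ← card_erase_add_one (mem_univ l)]
  omega

theorem IsSeparation.exists_lt_adjForm_compl_of_card_lt {ι : Type*} [Fintype ι] {f : V → ι}
    (hf : IsSeparation G S f) {s m t i g : ℕ} (hS : #S = s + i)
    (hι : Fintype.card ι = t + g + 1) (hcard : Fintype.card V = s + (m + t)) (ht : 0 < t)
    (hi : 0 < i) (hm : 4 * t * i + g * (g + 1 + 2 * i) ≤ 2 * g * m) {A B C : ℝ} (hA : 0 ≤ A)
    (hB : 0 < B) (hC : 0 ≤ C) (hCB : C < 2 * B) :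
    ∃ Z₁ Z₃ : Finset V, Disjoint Z₁ Z₃ ∧ #Z₁ = s ∧ #Z₃ = t ∧
      2 * t * m * (B * C) + t * (t - 1) * C ^ 2 < adjForm Gᶜ (blockWeight Z₁ Z₃ A B C) := by
  classical
  have : Nonempty ι := Fintype.card_pos_iff.1 (hι ▸ Nat.succ_pos _)
  obtain ⟨l₀, -, hmax⟩ := exists_max_image univ (fun l => #(part S f l)) univ_nonempty
  have hSc : #Sᶜ + (s + i) = s + (m + t) := by rw [← hS, ← hcard, card_compl_add_card]
  have hl₀ := hf.card_part_add_card_le l₀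
  have hl₀' := card_pos.2 (hf.part_nonempty l₀)
  obtain ⟨m', hm'⟩ : ∃ m', #Sᶜ = t + g + m' := Nat.exists_eq_add_of_le (by omega)
  obtain ⟨Z₁, Z₃, hZ, hZ₁, hZ₃, hle⟩ := hf.exists_le_adjForm_crossGraph
    (fun l => hmax l (mem_univ l)) (hS ▸ Nat.le_add_right s i) hι hm' hB.le A C
  refine ⟨Z₁, Z₃, hZ, hZ₁, hZ₃, lt_of_lt_of_le ?_ (hle.trans (adjForm_mono hf.crossGraph_le_compl
    (blockWeight_nonneg Z₁ Z₃ hA hB.le hC)))⟩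
  have hgain : 0 ≤ 2 * B * (2 * B - max B C) * (m' - #(part S f l₀)) :=
    mul_nonneg (mul_nonneg (by positivity) (sub_nonneg.2 (max_le (by linarith) hCB.le)))
      (sub_nonneg.2 (by exact_mod_cast (by omega : #(part S f l₀) ≤ m')))
  have hmm' : (m : ℝ) = m' + i + g := by exact_mod_cast (by omega : m = m' + i + g)
  have hm : (4 * t * i + g * (g + 1 + 2 * i) : ℝ) ≤ 2 * g * m := by exact_mod_cast hm
  have hloss : (2 * t * i * B) * C < (2 * t * i * B) * (2 * B) :=
    mul_lt_mul_of_pos_left hCB (by positivity)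
  rw [hmm'] at hm ⊢
  linarith [mul_le_mul_of_nonneg_right hm (sq_nonneg B)]

theorem IsSeparation.nonempty_iso_joinGraph {ι : Type*} [Fintype ι] {f : V → ι}
    (hf : IsSeparation G S f) {s m t : ℕ} (hS : #S = s) (hι : Fintype.card ι = t + 1)
    (hcard : Fintype.card V = s + (m + t)) {A B C : ℝ} (hA : 0 < A) (hB : 0 < B) (hC : 0 < C)
    (hCB : C < 2 * B)
    (hG : ∀ Z₁ Z₃ : Finset V, Disjoint Z₁ Z₃ → #Z₁ = s → #Z₃ = t →
      adjForm Gᶜ (blockWeight Z₁ Z₃ A B C) ≤ 2 * t * m * (B * C) + t * (t - 1) * C ^ 2) :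
    Nonempty (G ≃g joinGraph s m t) := by
  classical
  have : Nonempty ι := Fintype.card_pos_iff.1 (hι ▸ Nat.succ_pos _)
  obtain ⟨l₀, -, hmax⟩ := exists_max_image univ (fun l => #(part S f l)) univ_nonempty
  have hSc : #Sᶜ = t + m := by
    have := card_compl_add_card S
    omega
  have hl₀ : #(part S f l₀) ≤ m := by
    have := hf.card_part_add_card_le l₀
    omega
  obtain ⟨Z₁, Z₃, hZ, hZ₁, hZ₃, hle⟩ := hf.exists_le_adjForm_crossGraph (g := 0)
    (fun l => hmax l (mem_univ l)) hS.ge hι hSc hB.le A C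
  have hpos : ∀ v, 0 < blockWeight Z₁ Z₃ A B C v := fun v => by
    unfold blockWeight
    split_ifs <;> assumption
  have hcross := adjForm_mono hf.crossGraph_le_compl fun v => (hpos v).le
  have hup := hG Z₁ Z₃ hZ hZ₁ hZ₃
  have hmaxB : 0 < 2 * B * (2 * B - max B C) :=
    mul_pos (by positivity) (sub_pos.2 (max_lt (by linarith) hCB))
  have hgain : 0 ≤ 2 * B * (2 * B - max B C) * (m - #(part S f l₀)) :=
    mul_nonneg hmaxB.le (sub_nonneg.2 (by exact_mod_cast hl₀))
  rw [Nat.cast_zero] at hle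
  have hml₀ : (m : ℝ) - #(part S f l₀) ≤ 0 :=
    nonpos_of_mul_nonpos_right (by linarith) hmaxB
  have hcompl : crossGraph S f = Gᶜ :=
    eq_of_le_of_adjForm_le hf.crossGraph_le_compl hpos (by linarith)
  exact nonempty_iso_joinGraph_of_compl_eq_crossGraph hf hcompl.symm hS hι hcard
    (by exact_mod_cast sub_nonpos.1 hml₀)

end Extremal

section SpectralExtremality

open Finset

variable {V : Type*} [Fintype V] [DecidableEq V] {G : SimpleGraph V} {S : Finset V}

theorem IsSeparation.exists_lt_adjForm_compl_of_card_lt_minDegree [DecidableRel G.Adj]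
    {b r j m t : ℕ} {f : V → Fin (b * r + 2)} (hf : IsSeparation G S f) (hb : 0 < b) (hr : 0 < r)
    (hj : 0 < j) (hδ : G.minDegree = #S + j) (ht : t = b * (r + j) + 1)
    (hcard : Fintype.card V = #S + j + (m + t)) (hm : 2 * t ^ 2 ≤ m) {A B C : ℝ} (hA : 0 < A)
    (hAB : A ≤ B) (hC : 0 ≤ C) (hCA : C ≤ 2 * A) :
    ∃ Z₁ Z₃ : Finset V, Disjoint Z₁ Z₃ ∧ #Z₁ = #S + j ∧ #Z₃ = t ∧
      2 * t * m * (B * C) + t * (t - 1) * C ^ 2 < adjForm Gᶜ (blockWeight Z₁ Z₃ A B C) := by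
  obtain ⟨g, hg, htrue, hfalse⟩ := hf.exists_bool (c := j + 1) fun l => by
    have := hf.minDegree_lt_card_add_card_part l
    omega
  refine hg.exists_lt_adjForm_compl hA hAB hC hCA hcard hj rfl (hfalse.trans' ?_) ?_ hm
  · calc t + j = b * 1 * j + b * r + j + 1 := by rw [ht]; ring
      _ ≤ b * r * j + b * r + j + 1 := by gcongr; exact hr
      _ = (b * r + 1) * (j + 1) := by ring
  · by_contra! hle
    have hlabels : b * r + 2 ≤ t := by
      have := Nat.mul_pos hb hj
      rw [ht, Nat.mul_add]
      omega
    have hSc : #Sᶜ = j + (m + t) := by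
      have := card_compl_add_card S
      omega
    have : #Sᶜ ≤ 2 * t ^ 2 := by
      calc #Sᶜ ≤ (b * r + 2) * #(part S g true) := htrue
        _ ≤ t * (2 * t) := Nat.mul_le_mul hlabels hle
        _ = 2 * t ^ 2 := by ring
    omega

theorem IsSeparation.exists_lt_adjForm_compl_of_lt_card {b d i s m t : ℕ}
    {f : V → Fin (b * (d + i) + 2)} (hf : IsSeparation G S f) (hb : 0 < b) (hi : 0 < i)
    (hS : #S = s + i) (ht : t = b * d + 1) (hcard : Fintype.card V = s + (m + t))
    (hm : 8 * d + 7 ≤ m) {A B C : ℝ} (hA : 0 ≤ A) (hB : 0 < B) (hC : 0 ≤ C) (hCB : C < 2 * B) :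
    ∃ Z₁ Z₃ : Finset V, Disjoint Z₁ Z₃ ∧ #Z₁ = s ∧ #Z₃ = t ∧
      2 * t * m * (B * C) + t * (t - 1) * C ^ 2 < adjForm Gᶜ (blockWeight Z₁ Z₃ A B C) := by
  have hι : Fintype.card (Fin (b * (d + i) + 2)) = t + b * i + 1 := by
    rw [Fintype.card_fin, ht]
    ring
  have hmi : b * i + i + 1 ≤ m := by
    have := hf.card_part_add_card_le 0
    have := card_pos.2 (hf.part_nonempty 0)
    have := card_compl_add_card S
    omega
  refine hf.exists_lt_adjForm_compl_of_card_lt hS hι hcard (by omega) hi ?_ hA hB hC hCB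
  have hbi : i ≤ b * i := Nat.le_mul_of_pos_left i hb
  have hdm : 4 * (d + 1) + (b * i + 1 + 2 * i) ≤ 2 * m := by omega
  calc 4 * t * i + b * i * (b * i + 1 + 2 * i)
      ≤ b * i * (4 * (d + 1)) + b * i * (b * i + 1 + 2 * i) := by
        rw [ht]
        nlinarith
    _ = b * i * (4 * (d + 1) + (b * i + 1 + 2 * i)) := by ring
    _ ≤ b * i * (2 * m) := Nat.mul_le_mul_left _ hdm
    _ = 2 * (b * i) * m := by ring

theorem IsSeparation.nonempty_iso_joinGraph_of_distSpectralRadius_le [DecidableRel G.Adj]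
    {b k d r m t : ℕ} {f : V → Fin (b * r + 2)} (hf : IsSeparation G S f) (hG : G.Connected)
    (hb : 0 < b) (hr : 0 < r) (hS : #S = k + r) (hδ : G.minDegree = k + d) (ht : t = b * d + 1)
    (hcard : Fintype.card V = k + d + (m + t)) (hm : 2 * t ^ 2 + 3 * t + 2 ≤ m)
    (hμ : distSpectralRadius G ≤ distSpectralRadius (joinGraph (k + d) m t)) :
    Nonempty (G ≃g joinGraph (k + d) m t) := by
  have hdt : d ≤ b * d := Nat.le_mul_of_pos_left d hb
  have ht₀ : 0 < t := by omega
  have : Nontrivial V := Fintype.one_lt_card_iff_nontrivial.1 (by omega)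
  have hk : 0 < k + d := hδ ▸ hG.preconnected.minDegree_pos_of_nontrivial
  obtain ⟨A, B, C, hA, hAB, hC, hCA, hup⟩ :=
    exists_adjForm_compl_blockWeight_le hG hk ht₀ hcard hμ
  have hB : 0 < B := hA.trans hAB
  have hCB : C < 2 * B := by linarith
  rcases lt_trichotomy r d with hrd | rfl | hdr
  · obtain ⟨j, rfl⟩ := Nat.exists_eq_add_of_le hrd.le
    rw [← Nat.add_assoc, ← hS] at hδ hup
    obtain ⟨Z₁, Z₃, hZ, hZ₁, hZ₃, hlt⟩ := hf.exists_lt_adjForm_compl_of_card_lt_minDegree (m := m)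
      hb hr (by omega) hδ ht (by omega) (by omega) hA hAB.le hC.le hCA
    exact absurd hlt (hup Z₁ Z₃ hZ hZ₁ hZ₃).not_gt
  · exact hf.nonempty_iso_joinGraph hS (by rw [Fintype.card_fin, ht]) hcard hA hB hC hCB hup
  · obtain ⟨i, rfl⟩ := Nat.exists_eq_add_of_le hdr.le
    have hmd : 8 * d + 7 ≤ m := by
      have : (d + 1) ^ 2 ≤ t ^ 2 := Nat.pow_le_pow_left (by omega) 2
      nlinarith [Nat.le_mul_self d]
    obtain ⟨Z₁, Z₃, hZ, hZ₁, hZ₃, hlt⟩ := hf.exists_lt_adjForm_compl_of_lt_card hb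
      (by omega) (hS.trans (Nat.add_assoc k d i).symm) ht hcard hmd hA.le hB hC.le hCB
    exact absurd hlt (hup Z₁ Z₃ hZ hZ₁ hZ₃).not_gt

end SpectralExtremality

theorem theorem1p5_general {V : Type*} [Fintype V] [DecidableEq V] (G : SimpleGraph V)
    [DecidableRel G.Adj] (b k n δ : ℕ) (hnk : n ≡ k [MOD 2]) (hbodd : Odd b)
    (hcard : Fintype.card V = n) (hconn : IsKConnected G (k + 1)) (hδ : G.minDegree = δ)
    -- `δ - k` does not truncate: a `(k + 1)`-connected graph has `k < δ`
    (hbound : δ + 2 * (b * (δ - k) + 2) ^ 2 ≤ n)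
    (hμ : distSpectralRadius G ≤ distSpectralRadius (extremalGraph n b k δ)) :
    IsKCriticalOddFactor G k b ∨ Nonempty (G ≃g extremalGraph n b k δ) := by
  refine or_iff_not_imp_left.2 fun hcrit => ?_
  obtain ⟨S, r, f, hS, hf⟩ :=
    exists_isSeparation_of_not_isKCriticalOddFactor hbodd hconn.1 (hcard ▸ hnk) hcrit
  have hr : 0 < r := by
    have := hconn.le_card_of_isSeparation hf
    omega
  obtain ⟨d, rfl⟩ : ∃ d, δ = k + d :=
    Nat.exists_eq_add_of_le (hδ ▸ (Nat.le_succ k).trans hconn.le_minDegree)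
  have ht : b * (k + d) - b * k + 1 = b * d + 1 := by rw [Nat.mul_add, Nat.add_sub_cancel_left]
  have hbk : (b + 1) * (k + d) = b * k + (b * d + (k + d)) := by ring
  rw [Nat.add_sub_cancel_left] at hbound
  have hsq : 2 * (b * d + 2) ^ 2 = 2 * (b * d + 1) ^ 2 + 3 * (b * d + 1) + 2 + (b * d + 1) := by
    ring
  exact hf.nonempty_iso_joinGraph_of_distSpectralRadius_le (hconn.connected k.succ_pos)
    hbodd.pos hr hS hδ ht (by omega) (by rw [ht]; omega) hμ

theorem add_two_mul_sq_le_of_cubic_le {b k d n : ℝ} (hk : 1 ≤ k) (hd : 1 ≤ d)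
    (hbd : 2 ≤ b ∨ 1 ≤ b ∧ 4 ≤ d)
    (h : 2 / 3 * b ^ 2 * (k + d) ^ 3 + 4 / 3 * b ^ 2 * k * (k + d) ^ 2 ≤ n) :
    k + d + 2 * (b * d + 2) ^ 2 ≤ n := by
  refine le_trans ?_ h
  rcases hbd with hb | ⟨hb, hd⟩
  · have hsq : (b * d + 2) ^ 2 ≤ (b * (k + d)) ^ 2 :=
      pow_le_pow_left₀ (by positivity) (by nlinarith) 2
    have hlin : k + d ≤ 2 / 3 * (b * (k + d)) ^ 2 := by
      have : 4 ≤ b * (k + d) := by nlinarith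
      nlinarith
    have hcub : (b * (k + d)) ^ 2 * 4 ≤ (b * (k + d)) ^ 2 * (3 * k + d) :=
      mul_le_mul_of_nonneg_left (by linarith) (by positivity)
    linarith
  · have hsq : (b * d + 2) ^ 2 ≤ (6 / 5 * (b * (k + d))) ^ 2 :=
      pow_le_pow_left₀ (by positivity) (by nlinarith) 2
    have hlin : k + d ≤ 1 / 5 * (b * (k + d)) ^ 2 := by
      have : k + d ≤ b * (k + d) := by nlinarith
      nlinarith
    have hcub : (b * (k + d)) ^ 2 * 7 ≤ (b * (k + d)) ^ 2 * (3 * k + d) :=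
      mul_le_mul_of_nonneg_left (by linarith) (by positivity)
    nlinarith [sq_nonneg (b * (k + d))]

theorem add_two_mul_sq_le_of_max_le {b k δ n : ℕ} (hb : 0 < b) (hk : 0 < k) (hkδ : k < δ)
    (h : max
        ((2 * (b : ℝ) ^ 2 + 3 * b + 11) * δ - (2 * (b : ℝ) ^ 2 + 5 / 2 * b + 3 / 2) * k
          + 3 / 2 * b + 2 + 3 / (2 * (b : ℝ)))
        (2 / 3 * (b : ℝ) ^ 2 * (δ : ℝ) ^ 3 + 4 / 3 * (b : ℝ) ^ 2 * k * (δ : ℝ) ^ 2) ≤ (n : ℝ)) :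
    δ + 2 * (b * (δ - k) + 2) ^ 2 ≤ n := by
  obtain ⟨hlin, hcub⟩ := max_le_iff.1 h
  obtain ⟨d, rfl⟩ := Nat.exists_eq_add_of_le hkδ.le
  rw [Nat.add_sub_cancel_left]
  have hb₁ : (1 : ℝ) ≤ b := by exact_mod_cast hb
  have hk₁ : (1 : ℝ) ≤ k := by exact_mod_cast hk
  push_cast at hlin hcub
  by_cases hbd : 2 ≤ b ∨ 4 ≤ d
  · exact_mod_cast add_two_mul_sq_le_of_cubic_le hk₁ (by exact_mod_cast (by omega : 1 ≤ d))
      (hbd.imp (by exact_mod_cast id) fun hd => ⟨hb₁, by exact_mod_cast hd⟩) hcub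
  · obtain rfl : b = 1 := by omega
    have hlin' : 16 * d + 10 * k + 5 ≤ n := by
      norm_num at hlin
      exact_mod_cast (by linarith : (16 * d + 10 * k + 5 : ℝ) ≤ n)
    have hd : d ≤ 3 := by omega
    interval_cases d <;> omega

theorem theorem1p5 {V : Type*} [Fintype V] [DecidableEq V]
    (G : SimpleGraph V) [DecidableRel G.Adj] (b k n δ : ℕ)
    (hb : 0 < b) (hk : 0 < k) (hn : 0 < n)
    (hnk : n ≡ k [MOD 2]) (hbodd : Odd b)
    (hcard : Fintype.card V = n)
    (hconn : IsKConnected G (k + 1))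
    (hδ : G.minDegree = δ)
    (hbound : max
        ((2 * (b : ℝ) ^ 2 + 3 * b + 11) * δ - (2 * (b : ℝ) ^ 2 + 5 / 2 * b + 3 / 2) * k
          + 3 / 2 * b + 2 + 3 / (2 * (b : ℝ)))
        (2 / 3 * (b : ℝ) ^ 2 * (δ : ℝ) ^ 3 + 4 / 3 * (b : ℝ) ^ 2 * k * (δ : ℝ) ^ 2) ≤ (n : ℝ))
    (hμ : distSpectralRadius G ≤ distSpectralRadius (extremalGraph n b k δ)) :
    IsKCriticalOddFactor G k b ∨ Nonempty (G ≃g extremalGraph n b k δ) :=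
  theorem1p5_general G b k n δ hnk hbodd hcard hconn hδ
    (add_two_mul_sq_le_of_max_le hb hk (hδ ▸ hconn.le_minDegree) hbound) hμ
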